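/- **Theorem (Optimal stopping time).** Let $E$ be a (standard) Borel space and let $Q(t,B\mid x)$ ($t\in\mathbb R_+=[0,\infty)$, $B\in\mathcal B(E)$, $x\in E$) be a semi-Markov kernel: for all $B$ and $x$ the function $t\mapsto Q(t,B\mid x)$ is non-decreasing and right continuous with $Q(0,B\mid x)=0$; for each $t$, $Q(t,\cdot\mid\cdot)$ is a sub-stochastic kernel on $E$; and $\lim_{t\to\infty}Q(t,\cdot\mid\cdot)$ is a stochastic kernel on $E$. On the space $\Omega$ of sequences $\omega=(x_0,t_1,x_1,t_2,x_2,\dots)$ with $x_n\in E$, $t_n\in\mathbb R_+$ (with the product $\sigma$-algebra) put $X_n(\omega)=x_n$, $T_0=0$, $T_{n+1}(\omega)=t_{n+1}$, $S_n=\sum_{k=0}^nT_k$ and $\mathcal F_n=\sigma(T_0,X_0,\dots,T_n,X_n)$. Let $\mathbb P_x$ be the unique probability measure on $\Omega$ with $\mathbb P_x(X_0=x)=1$ and $$\mathbb P_x(T_{n+1}\le t,\,X_{n+1}\in B\mid T_0,X_0,\dots,T_n,X_n)=Q(t,B\mid X_n)\qquad(n\ge0),$$ and let $\mathbb E_x$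 be the expectation under $\mathbb P_x$. Let $X(t)=X_n$ for $S_n\le t<S_{n+1}$. A stopping time is a map $\tau:\Omega\to\mathbb N\cup\{\infty\}$ (with $0\in\mathbb N$) such that $\{\tau=n\}\in\mathcal F_n$ for all $n\in\mathbb N$; put $S_\infty=\lim_nS_n$. Let $c,g:E\to[0,\infty)$ be measurable. For a horizon $s\in\mathbb R_+$ and a stopping time $\tau$ let $$R^s_\tau=\begin{cases}\displaystyle\int_0^{S_\tau}c(X(t))\,dt+g(X(S_\tau)), & S_\tau<s,\\[2mm] \displaystyle\int_0^{s}c(X(t))\,dt, & S_\tau\ge s,\end{cases}\qquad V^\tau(s,x)=\mathbb E_x[R^s_\tau]\in[0,\infty],\qquad V^*(s,x)=\inf_\tau V^\tau(s,x),$$ where the infimum is over all stopping times and $c(X(t))$, $g(X(t))$ are read as $0$ for $t\ge\lim_nS_n$. Suppose that there are $\delta>0$ and $\varepsilon>0$ with $Q(\delta,E\mid x)\le1-\varepsilon$ for all $x\in E$. Fix $T\in\mathbb R_+$, and put $$D^*=\{(s,x)\in(0,T]\times E:\ V^*(s,x)=g(x)\},$$ $$\tau^*=\min\bigl\{\inf\{n\ge0:(T-S_n,X_n)\in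 D^*\},\ \inf\{n\ge0:S_n\ge T\}\bigr\},\qquad\inf\emptyset=\infty.$$ Then $\tau^*$ is a $T$-optimal stopping time, that is, $\tau^*$ is a stopping time and $V^{\tau^*}(T,x)=V^*(T,x)$ for all $x\in E$; and $\mathbb P_x(\tau^*=\infty)=0$ for all $x\in E$. -/

import Mathlib

open MeasureTheory ProbabilityTheory Filter Topology Set
open scoped NNReal ENNReal

noncomputable section

/-- A semi-Markov kernel `Q(t, B | x)` on `ℝ₊ × E` given `E`; here `Q.ker t x B = Q(t, B | x)`.
For measurable `B`, `t ↦ Q(t, B | x)` is non-decreasing and right continuous with `Q(0, B | x) = 0`;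
`Q(t, · | ·)` is a sub-stochastic kernel for each `t`, and the limit as `t → ∞` is a stochastic
kernel. -/
structure SemiMarkovKernel (E : Type*) [MeasurableSpace E] where
  ker : ℝ≥0 → Kernel E E
  mono : ∀ (x : E) (B : Set E), MeasurableSet B → Monotone fun t => ker t x B
  right_cont : ∀ (x : E) (B : Set E), MeasurableSet B →
    ∀ t, ContinuousWithinAt (fun t => ker t x B) (Ici t) t
  zero : ∀ (x : E) (B : Set E), MeasurableSet B → ker 0 x B = 0
  substochastic : ∀ (t : ℝ≥0) (x : E), ker t x univ ≤ 1
  stochastic_limit : ∃ κ : Kernel E E, IsMarkovKernel κ ∧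
    ∀ (x : E) (B : Set E), MeasurableSet B → Tendsto (fun t => ker t x B) atTop (𝓝 (κ x B))

namespace SemiMarkovKernel

variable {E : Type*} [MeasurableSpace E] (Q : SemiMarkovKernel E)

/-- The stochastic kernel `lim_{t → ∞} Q(t, · | ·)`. -/
def limit : Kernel E E := Q.stochastic_limit.choose

instance : IsMarkovKernel Q.limit := Q.stochastic_limit.choose_spec.1

lemma tendsto_limit (x : E) {B : Set E} (hB : MeasurableSet B) :
    Tendsto (fun t => Q.ker t x B) atTop (𝓝 (Q.limit x B)) :=
  Q.stochastic_limit.choose_spec.2 x B hB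

instance (t : ℝ≥0) : IsFiniteKernel (Q.ker t) :=
  ⟨1, ENNReal.one_lt_top, Q.substochastic t⟩

lemma ker_le_limit (t : ℝ≥0) (x : E) {B : Set E} (hB : MeasurableSet B) :
    Q.ker t x B ≤ Q.limit x B :=
  (Q.mono x B hB).ge_of_tendsto (Q.tendsto_limit x hB) t

lemma ker_absolutelyContinuous (t : ℝ≥0) (x : E) : Q.ker t x ≪ Q.limit x :=
  Measure.AbsolutelyContinuous.mk fun _ hB h =>
    le_antisymm (h ▸ Q.ker_le_limit t x hB) zero_le

/-- The density of `Q(t, · | x)` with respect to the limit kernel: a version of the conditional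
probability that the sojourn time is at most `t`, given both the present and the next state. -/
def dens [StandardBorelSpace E] (p : E × E) (q : ℚ) : ℝ≥0∞ :=
  Kernel.rnDeriv (Q.ker (q : ℝ).toNNReal) Q.limit p.1 p.2

lemma measurable_dens [StandardBorelSpace E] (q : ℚ) : Measurable fun p => Q.dens p q :=
  Kernel.measurable_rnDeriv _ _

lemma measurable_dens_right [StandardBorelSpace E] (x : E) (q : ℚ) :
    Measurable fun y => Q.dens (x, y) q :=
  (Q.measurable_dens q).comp measurable_prodMk_left

lemma measurable_dens_toReal [StandardBorelSpace E] :
    Measurable fun (p : E × E) (q : ℚ) => (Q.dens p q).toReal :=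
  measurable_pi_lambda _ fun q => (Q.measurable_dens q).ennreal_toReal

lemma setLIntegral_dens [StandardBorelSpace E] (x : E) (q : ℚ) {B : Set E}
    (hB : MeasurableSet B) :
    ∫⁻ y in B, Q.dens (x, y) q ∂(Q.limit x) = Q.ker (q : ℝ).toNNReal x B :=
  Kernel.setLIntegral_rnDeriv (Q.ker_absolutelyContinuous _ x) hB

lemma lintegral_dens [StandardBorelSpace E] (x : E) (q : ℚ) :
    ∫⁻ y, Q.dens (x, y) q ∂(Q.limit x) = Q.ker (q : ℝ).toNNReal x univ := by
  rw [← setLIntegral_univ, Q.setLIntegral_dens x q MeasurableSet.univ]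

lemma dens_mono [StandardBorelSpace E] (x : E) :
    ∀ᵐ y ∂(Q.limit x), ∀ q r : ℚ, q ≤ r → Q.dens (x, y) q ≤ Q.dens (x, y) r := by
  rw [ae_all_iff]; intro q
  rw [ae_all_iff]; intro r
  by_cases h : q ≤ r
  · have : ∀ᵐ y ∂(Q.limit x), Q.dens (x, y) q ≤ Q.dens (x, y) r := by
      refine ae_le_of_forall_setLIntegral_le_of_sigmaFinite (Q.measurable_dens_right x q) ?_
      intro B hB _
      rw [Q.setLIntegral_dens x q hB, Q.setLIntegral_dens x r hB]
      exact Q.mono x B hB (Real.toNNReal_mono (by exact_mod_cast h))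
    filter_upwards [this] with y hy _ using hy
  · exact Eventually.of_forall fun y hy => absurd hy h

lemma dens_le_one [StandardBorelSpace E] (x : E) :
    ∀ᵐ y ∂(Q.limit x), ∀ q : ℚ, Q.dens (x, y) q ≤ 1 := by
  rw [ae_all_iff]; intro q
  refine ae_le_of_forall_setLIntegral_le_of_sigmaFinite (Q.measurable_dens_right x q) ?_
  intro B hB _
  rw [Q.setLIntegral_dens x q hB]
  simpa using Q.ker_le_limit _ x hB

lemma dens_neg [StandardBorelSpace E] (x : E) :
    ∀ᵐ y ∂(Q.limit x), ∀ q : ℚ, q ≤ 0 → Q.dens (x, y) q = 0 := by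
  rw [ae_all_iff]; intro q
  by_cases h : q ≤ 0
  · have h0 : (q : ℝ).toNNReal = 0 := Real.toNNReal_of_nonpos (by exact_mod_cast h)
    have : ∫⁻ y, Q.dens (x, y) q ∂(Q.limit x) = 0 := by
      rw [Q.lintegral_dens, h0, Q.zero x _ MeasurableSet.univ]
    rw [lintegral_eq_zero_iff (Q.measurable_dens_right x q)] at this
    filter_upwards [this] with y hy _ using hy
  · exact Eventually.of_forall fun y hy => absurd hy h

lemma dens_iSup [StandardBorelSpace E] (x : E) :
    ∀ᵐ y ∂(Q.limit x), ⨆ q : ℚ, Q.dens (x, y) q = 1 := by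
  refine ae_eq_of_ae_le_of_lintegral_le (f := fun y => ⨆ q : ℚ, Q.dens (x, y) q)
    (g := fun _ => 1) ?_ ?_ aemeasurable_const ?_
  · filter_upwards [Q.dens_le_one x] with y hy using iSup_le hy
  · refine ((lintegral_mono_ae (g := fun _ => 1) ?_).trans_lt ?_).ne
    · filter_upwards [Q.dens_le_one x] with y hy using iSup_le hy
    · simp
  · have h := Q.tendsto_limit x MeasurableSet.univ
    simp only [lintegral_const, measure_univ, mul_one] at h ⊢
    refine le_of_tendsto' (h.comp tendsto_natCast_atTop_atTop) fun n => ?_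
    have h2 := Q.lintegral_dens x (n : ℚ)
    have h3 : (((n : ℚ) : ℝ)).toNNReal = (n : ℝ≥0) := by simp
    rw [h3] at h2
    rw [Function.comp, ← h2]
    exact lintegral_mono fun y => le_iSup (fun q : ℚ => Q.dens (x, y) q) (n : ℚ)

lemma exists_seq_rat (t : ℝ) : ∃ u : ℕ → ℚ, StrictAnti u ∧ (∀ n, t < u n) ∧
    Tendsto (fun n => (u n : ℝ)) atTop (𝓝 t) :=
  Real.exists_seq_rat_strictAnti_tendsto t

lemma tendsto_ker_seq (x : E) {B : Set E} (hB : MeasurableSet B) (t : ℝ) (u : ℕ → ℚ)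
    (hu : ∀ n, t < u n) (hut : Tendsto (fun n => (u n : ℝ)) atTop (𝓝 t)) :
    Tendsto (fun n => Q.ker (u n : ℝ).toNNReal x B) atTop (𝓝 (Q.ker t.toNNReal x B)) := by
  have h1 : Tendsto (fun n => (u n : ℝ).toNNReal) atTop (𝓝[Ici t.toNNReal] t.toNNReal) := by
    refine tendsto_nhdsWithin_iff.2 ⟨?_, Eventually.of_forall fun n => ?_⟩
    · exact (continuous_real_toNNReal.tendsto t).comp hut
    · exact Real.toNNReal_mono (hu n).le
  exact (Q.right_cont x B hB t.toNNReal).tendsto.comp h1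

lemma dens_iInf [StandardBorelSpace E] (x : E) :
    ∀ᵐ y ∂(Q.limit x), ∀ q : ℚ, ⨅ r : Ioi q, Q.dens (x, y) r = Q.dens (x, y) q := by
  rw [ae_all_iff]; intro q
  have hmeas : Measurable fun y => ⨅ r : Ioi q, Q.dens (x, y) r :=
    Measurable.iInf fun r => Q.measurable_dens_right x r
  have key : (fun y => Q.dens (x, y) q) =ᵐ[Q.limit x] fun y => ⨅ r : Ioi q, Q.dens (x, y) r := by
    refine ae_eq_of_ae_le_of_lintegral_le ?_ ?_ hmeas.aemeasurable ?_
    · filter_upwards [Q.dens_mono x] with y hy using le_iInf fun r => hy q r r.2.le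
    · rw [Q.lintegral_dens]; exact measure_ne_top _ _
    · obtain ⟨u, -, hu, hut⟩ := exists_seq_rat (q : ℝ)
      rw [Q.lintegral_dens]
      refine ge_of_tendsto' (Q.tendsto_ker_seq x MeasurableSet.univ q u hu hut) fun n => ?_
      rw [← Q.lintegral_dens]
      exact lintegral_mono fun y =>
        iInf_le (fun r : Ioi q => Q.dens (x, y) r) ⟨u n, by exact_mod_cast hu n⟩
  filter_upwards [key] with y hy using hy.symm

lemma isRatStieltjesPoint_dens [StandardBorelSpace E] (x : E) :
    ∀ᵐ y ∂(Q.limit x),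
      IsRatStieltjesPoint (fun (p : E × E) (q : ℚ) => (Q.dens p q).toReal) (x, y) := by
  filter_upwards [Q.dens_mono x, Q.dens_le_one x, Q.dens_neg x, Q.dens_iSup x, Q.dens_iInf x]
    with y hmono hone hneg hsup hinf
  have hfin : ∀ q, Q.dens (x, y) q ≠ ∞ := fun q => ((hone q).trans_lt ENNReal.one_lt_top).ne
  have hm : Monotone fun q : ℚ => Q.dens (x, y) q := fun q r h => hmono q r h
  refine ⟨fun q r h => ENNReal.toReal_mono (hfin r) (hmono q r h), ?_, ?_, fun t => ?_⟩
  · have h := tendsto_atTop_iSup hm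
    rw [hsup] at h
    have h' := (ENNReal.tendsto_toReal ENNReal.one_ne_top).comp h
    rw [ENNReal.toReal_one] at h'
    exact h'
  · refine tendsto_const_nhds.congr' ?_
    filter_upwards [eventually_le_atBot (0 : ℚ)] with q hq
    simp [hneg q hq]
  · rw [← hinf t]
    exact (ENNReal.toReal_iInf fun r : Ioi t => hfin r).symm

/-- The kernel whose value at `(x, y)` is the conditional law of the sojourn time, given the present
state `x` and the next state `y`. -/
def sojourn [StandardBorelSpace E] : Kernel (E × E) ℝ where
  toFun p := (stieltjesOfMeasurableRat _ Q.measurable_dens_toReal p).measure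
  measurable' := measurable_measure_stieltjesOfMeasurableRat _

instance [StandardBorelSpace E] : IsMarkovKernel Q.sojourn :=
  ⟨fun p => instIsProbabilityMeasure_stieltjesOfMeasurableRat _ p⟩

/-- The stochastic kernel `Q(dt, dy | x)` on `ℝ₊ × E` given `E`. It is characterised by
`joint_apply`. -/
def joint [StandardBorelSpace E] : Kernel E (ℝ≥0 × E) :=
  (Q.limit ⊗ₖ Q.sojourn).map fun p => (p.2.toNNReal, p.1)

lemma measurable_swapNN : Measurable fun p : E × ℝ => (p.2.toNNReal, p.1) :=
  (measurable_real_toNNReal.comp measurable_snd).prodMk measurable_fst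

instance [StandardBorelSpace E] : IsMarkovKernel Q.joint :=
  Kernel.IsMarkovKernel.map _ measurable_swapNN

lemma compProd_apply_rat [StandardBorelSpace E] (x : E) {B : Set E} (hB : MeasurableSet B)
    (q : ℚ) :
    (Q.limit ⊗ₖ Q.sojourn) x (B ×ˢ Iic (q : ℝ)) = Q.ker (q : ℝ).toNNReal x B := by
  rw [Kernel.compProd_apply_prod hB measurableSet_Iic, ← Q.setLIntegral_dens x q hB]
  refine lintegral_congr_ae (ae_restrict_of_ae ?_)
  filter_upwards [Q.isRatStieltjesPoint_dens x, Q.dens_le_one x] with y hy hone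
  change (stieltjesOfMeasurableRat _ Q.measurable_dens_toReal (x, y)).measure (Iic (q : ℝ)) = _
  rw [measure_stieltjesOfMeasurableRat_Iic, stieltjesOfMeasurableRat_eq,
    toRatCDF_of_isRatStieltjesPoint hy,
    ENNReal.ofReal_toReal ((hone q).trans_lt ENNReal.one_lt_top).ne]

/-- The measure `Q(dt, dy | x)` gives `[0, t] × B` the mass `Q(t, B | x)`. -/
theorem joint_apply [StandardBorelSpace E] (t : ℝ≥0) (x : E) {B : Set E} (hB : MeasurableSet B) :
    Q.joint x (Iic t ×ˢ B) = Q.ker t x B := by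
  rw [joint, Kernel.map_apply' _ measurable_swapNN _ (measurableSet_Iic.prod hB)]
  have hpre : (fun p : E × ℝ => (p.2.toNNReal, p.1)) ⁻¹' (Iic t ×ˢ B) = B ×ˢ Iic (t : ℝ) := by
    ext p
    simp [Real.toNNReal_le_iff_le_coe, and_comm]
  rw [hpre]
  obtain ⟨u, hanti, hu, hut⟩ := exists_seq_rat (t : ℝ)
  have h1 := Q.tendsto_ker_seq x hB t u hu hut
  rw [Real.toNNReal_coe] at h1
  have h2 : Tendsto (fun n => (Q.limit ⊗ₖ Q.sojourn) x (B ×ˢ Iic (u n : ℝ))) atTop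
      (𝓝 ((Q.limit ⊗ₖ Q.sojourn) x (⋂ n, B ×ˢ Iic (u n : ℝ)))) := by
    refine tendsto_measure_iInter_atTop
      (fun n => (hB.prod measurableSet_Iic).nullMeasurableSet) ?_ ⟨0, measure_ne_top _ _⟩
    intro m n hmn
    exact prod_mono le_rfl (Iic_subset_Iic.2 (by exact_mod_cast hanti.antitone hmn))
  have h3 : (⋂ n, B ×ˢ Iic (u n : ℝ)) = B ×ˢ Iic (t : ℝ) := by
    ext p
    simp only [mem_iInter, mem_prod, mem_Iic]
    refine ⟨fun h => ⟨(h 0).1, ge_of_tendsto' hut fun n => (h n).2⟩,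
      fun h n => ⟨h.1, h.2.trans (hu n).le⟩⟩
  simp_rw [Q.compProd_apply_rat x hB, h3] at h2
  exact tendsto_nhds_unique h2 h1

/-- The assumption on `Q`: there are `δ > 0` and `ε > 0` with `Q(δ, E | x) ≤ 1 - ε` for all `x`. -/
def Regular : Prop :=
  ∃ δ : ℝ≥0, 0 < δ ∧ ∃ ε : ℝ, 0 < ε ∧ ∀ x : E, (Q.ker δ x).real univ ≤ 1 - ε

end SemiMarkovKernel

namespace SMP

variable {E : Type*} [MeasurableSpace E]

/-- The sample space of all `ω = (x₀, t₁, x₁, t₂, x₂, …)`: here `ω.1 = x₀` and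
`ω.2 n = (tₙ₊₁, xₙ₊₁)`. It carries the product σ-algebra. -/
abbrev Path (E : Type*) : Type _ := E × (ℕ → ℝ≥0 × E)

/-- The state `X_n` at the `n`-th jump. -/
def X : ℕ → Path E → E
  | 0, ω => ω.1
  | n + 1, ω => (ω.2 n).2

/-- `T_0 = 0`, and `T_{n+1}` is the sojourn time between the `n`-th and the `(n+1)`-th jump. -/
def T : ℕ → Path E → ℝ≥0
  | 0, _ => 0
  | n + 1, ω => (ω.2 n).1

/-- The `n`-th jump time `S_n = T_0 + ⋯ + T_n`. -/
def S (n : ℕ) (ω : Path E) : ℝ≥0 := ∑ k ∈ Finset.range (n + 1), T k ω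

lemma measurable_X (n : ℕ) : Measurable (X n : Path E → E) := by
  cases n with
  | zero => exact measurable_fst
  | succ n => exact measurable_snd.comp ((measurable_pi_apply n).comp measurable_snd)

lemma measurable_T (n : ℕ) : Measurable (T n : Path E → ℝ≥0) := by
  cases n with
  | zero => exact measurable_const
  | succ n => exact measurable_fst.comp ((measurable_pi_apply n).comp measurable_snd)

/-- The filtration `ℱ_n = σ(T_0, X_0, …, T_n, X_n)`. -/
def filtration (E : Type*) [MeasurableSpace E] :
    Filtration ℕ (inferInstance : MeasurableSpace (Path E)) where
  seq n := ⨆ k : Fin (n + 1), MeasurableSpace.comap (T k) inferInstance ⊔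
    MeasurableSpace.comap (X k) inferInstance
  mono' m n hmn := iSup_le fun k =>
    le_iSup (fun k : Fin (n + 1) => MeasurableSpace.comap (T (E := E) k) inferInstance ⊔
      MeasurableSpace.comap (X (E := E) k) inferInstance) ⟨k, by omega⟩
  le' _ := iSup_le fun k => sup_le (measurable_T k).comap_le (measurable_X k).comap_le

/-- The transition mechanism: given `(T_0, X_0, …, T_n, X_n)`, the pair `(T_{n+1}, X_{n+1})` has law
`Q(dt, dy | X_n)`. -/
def step [StandardBorelSpace E] (Q : SemiMarkovKernel E) (n : ℕ) :
    Kernel (Π _ : Finset.Iic n, ℝ≥0 × E) (ℝ≥0 × E) :=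
  Q.joint.comap (fun h => (h ⟨n, Finset.mem_Iic.2 le_rfl⟩).2)
    (measurable_snd.comp (measurable_pi_apply _))

instance [StandardBorelSpace E] (Q : SemiMarkovKernel E) (n : ℕ) : IsMarkovKernel (step Q n) :=
  Kernel.IsMarkovKernel.comap _ _

/-- The law `ℙ_x` on the sample space, by the Ionescu-Tulcea theorem: the sequence
`(T_n, X_n)` starts at `(0, x)` and has transition mechanism `step Q`. -/
def law [StandardBorelSpace E] (Q : SemiMarkovKernel E) (x : E) : Measure (Path E) :=
  (Kernel.trajMeasure (X := fun _ => ℝ≥0 × E) (Measure.dirac ((0 : ℝ≥0), x)) (step Q)).map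
    fun p => ((p 0).2, fun n => p (n + 1))

open Classical in
/-- The continuous-time state process: `X(t) = X_n` for `S_n ≤ t < S_{n+1}`. For `t` not below
`lim S_n` it is the cemetery `none`. -/
def process (ω : Path E) (t : ℝ) : Option E :=
  if h : ∃ n, (S n ω : ℝ) ≤ t ∧ t < S (n + 1) ω then some (X (Nat.find h) ω) else none

/-- Extension of a nonnegative function on `E` by `0` to the cemetery. -/
def extendZero (f : E → ℝ≥0) (o : Option E) : ℝ≥0∞ := o.elim 0 fun x => (f x : ℝ≥0∞)

/-- The jump time `S_n` for `n ∈ ℕ ∪ {∞}`, with `S_∞ = lim S_n`. -/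
def jumpTime : WithTop ℕ → Path E → ℝ≥0∞
  | (n : ℕ), ω => (S n ω : ℝ≥0∞)
  | ⊤, ω => ⨆ n, (S n ω : ℝ≥0∞)

/-- The cost `R_τ^s` of stopping at the jump number `τ(ω)`, with horizon `s`:
`∫₀^{S_τ} c(X(t)) dt + g(X(S_τ))` if `S_τ < s`, and `∫₀^s c(X(t)) dt` if `S_τ ≥ s`. -/
def cost (c g : E → ℝ≥0) (s : ℝ≥0) (τ : Path E → WithTop ℕ) (ω : Path E) : ℝ≥0∞ :=
  if jumpTime (τ ω) ω < s then
    (∫⁻ t in Ioc 0 (jumpTime (τ ω) ω).toReal, extendZero c (process ω t))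
      + extendZero g (process ω (jumpTime (τ ω) ω).toReal)
  else ∫⁻ t in Ioc 0 (s : ℝ), extendZero c (process ω t)

/-- The `s`-horizon expected cost `V^τ(s, x) = 𝔼_x[R_τ^s]`. -/
def expectedCost [StandardBorelSpace E] (Q : SemiMarkovKernel E) (c g : E → ℝ≥0)
    (τ : Path E → WithTop ℕ) (s : ℝ≥0) (x : E) : ℝ≥0∞ :=
  ∫⁻ ω, cost c g s τ ω ∂(law Q x)

/-- The value function `V*(s, x) = inf_τ V^τ(s, x)`, over all stopping times `τ`. -/
def value [StandardBorelSpace E] (Q : SemiMarkovKernel E) (c g : E → ℝ≥0)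
    (s : ℝ≥0) (x : E) : ℝ≥0∞ :=
  ⨅ (τ : Path E → WithTop ℕ) (_ : IsStoppingTime (filtration E) τ), expectedCost Q c g τ s x

/-- `τ` is an `H`-optimal stopping time: `V^τ(H, x) = V*(H, x)` for all `x`. -/
def IsOptimal [StandardBorelSpace E] (Q : SemiMarkovKernel E) (c g : E → ℝ≥0) (H : ℝ≥0)
    (τ : Path E → WithTop ℕ) : Prop :=
  IsStoppingTime (filtration E) τ ∧ ∀ x, expectedCost Q c g τ H x = value Q c g H x

/-- The set `D* = {(s, x) ∈ (0, H] × E : V*(s, x) = g(x)}`. -/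
def stoppingSet [StandardBorelSpace E] (Q : SemiMarkovKernel E) (c g : E → ℝ≥0) (H : ℝ≥0) :
    Set (ℝ≥0 × E) :=
  {p | p.1 ∈ Ioc 0 H ∧ value Q c g p.1 p.2 = (g p.2 : ℝ≥0∞)}

/-- `τ*` is the minimum of `inf {n | (H - S_n, X_n) ∈ D*}` and `inf {n | H ≤ S_n}`, where `inf ∅ = ∞`. The truncated
difference `H - S_n` is `0` if `H ≤ S_n`, and then the pair is not in `D*`. -/
def optimalTime [StandardBorelSpace E] (Q : SemiMarkovKernel E) (c g : E → ℝ≥0) (H : ℝ≥0)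
    (ω : Path E) : WithTop ℕ :=
  (⨅ (n : ℕ) (_ : (H - S n ω, X n ω) ∈ stoppingSet Q c g H), (n : WithTop ℕ)) ⊓
    ⨅ (n : ℕ) (_ : H ≤ S n ω), (n : WithTop ℕ)

end SMP

end

/-!
Write `Y_n = (s - S_n, X_n)` with truncated subtraction (`remaining`): the time left until the
horizon and the present state. Under `ℙ_x` this is a Markov chain started at `(s, x)`, and the
problem is one of optimal stopping of this chain. Since sojourn times are almost surely positive and
the jump times tend to `∞` (`law_S_unbounded`, from `𝔼_x[exp (-S_n)] ≤ ρ ^ n` with `ρ < 1`), almost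
surely
`R_τ^s = ∑ₙ 1{n < τ} c(X_n) min(T_{n+1}, s - S_n) + 1{τ = n} ĝ(Y_n)`,
where `ĝ(r, x) = g(x)` for `r > 0` and `ĝ(0, x) = 0` (`cost_eq_tsum`).

Value iteration starts at `u_0 = 0` and puts `u_{m+1} = min(ĝ, L u_m)`, where `L u` (`waitCost`) is
the expected cost of waiting for one more jump and then being charged `u`. The `u_m` increase to a
measurable function `U` (`iterLimit`), and `U = min(ĝ, L U)` by monotone convergence. By induction
on `m` every stopping time costs at least `u_m`; as `u_0 = 0`, no boundedness of `g` is needed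
here. Conversely, let `σ` be the first `n` with `U(Y_n) = ĝ(Y_n)` (`hitTime`). Before `σ` one has
`U = L U`, so the accumulated cost plus `U(Y_n)` is conserved in mean until `σ`, and dropping the
last term shows that `σ` costs at most `U`. Hence `V* = U` (`value_eq_iterLimit`), attained by `σ`.
With `V* = U`, the time `τ*` is `σ`: at the horizon `U = ĝ = 0`, and before it the criterion is
`V* = g`. It is finite because the jump times exceed the horizon eventually.
-/

noncomputable section

namespace SMP

variable {E : Type*} [MeasurableSpace E]

/-! ### The jump times and the filtration -/

omit [MeasurableSpace E] in
lemma S_zero (ω : Path E) : S 0 ω = 0 := by simp [S, T]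

omit [MeasurableSpace E] in
lemma S_succ (n : ℕ) (ω : Path E) : S (n + 1) ω = S n ω + T (n + 1) ω := by
  simp [S, Finset.sum_range_succ]

lemma measurable_T_filtration {k n : ℕ} (h : k ≤ n) :
    Measurable[filtration E n] (T k : Path E → ℝ≥0) :=
  (comap_measurable _).mono (le_sup_left.trans
    (le_iSup (fun k : Fin (n + 1) => MeasurableSpace.comap (T (E := E) k) inferInstance ⊔
      MeasurableSpace.comap (X (E := E) k) inferInstance) ⟨k, by omega⟩)) le_rfl

lemma measurable_X_filtration (n : ℕ) : Measurable[filtration E n] (X n : Path E → E) :=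
  (comap_measurable _).mono (le_sup_right.trans
    (le_iSup (fun k : Fin (n + 1) => MeasurableSpace.comap (T (E := E) k) inferInstance ⊔
      MeasurableSpace.comap (X (E := E) k) inferInstance) ⟨n, by omega⟩)) le_rfl

lemma measurable_S_filtration (n : ℕ) : Measurable[filtration E n] (S n : Path E → ℝ≥0) :=
  Finset.measurable_fun_sum _ fun k hk =>
    measurable_T_filtration (by have := Finset.mem_range.1 hk; omega)

lemma measurable_S (n : ℕ) : Measurable (S n : Path E → ℝ≥0) :=
  (measurable_S_filtration n).mono ((filtration E).le n) le_rfl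

/-- The sequence `(T_n, X_n)` of marked sojourn times, rewritten as a point of the sample space. -/
def toPath (p : ℕ → ℝ≥0 × E) : Path E := ((p 0).2, fun n => p (n + 1))

lemma measurable_toPath : Measurable (toPath : (ℕ → ℝ≥0 × E) → Path E) := by
  unfold toPath; fun_prop

/-- The past `ℱ_n` is determined by the trajectory up to time `n`. -/
lemma comap_toPath_filtration_le (n : ℕ) :
    (filtration E n).comap toPath ≤
      MeasurableSpace.comap (Preorder.frestrictLe (π := fun _ => ℝ≥0 × E) n) inferInstance := by
  have key : ∀ k (h : k ≤ n), Measurable[MeasurableSpace.comap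
      (Preorder.frestrictLe (π := fun _ => ℝ≥0 × E) n) inferInstance]
      (fun p : ℕ → ℝ≥0 × E => p k) := fun k h =>
    (measurable_pi_apply (X := fun _ : Finset.Iic n => ℝ≥0 × E) ⟨k, Finset.mem_Iic.2 h⟩).comp
      (comap_measurable (Preorder.frestrictLe (π := fun _ => ℝ≥0 × E) n))
  change (⨆ k : Fin (n + 1), MeasurableSpace.comap (T k) inferInstance ⊔
    MeasurableSpace.comap (X k) inferInstance).comap toPath ≤ _
  rw [MeasurableSpace.comap_iSup]
  refine iSup_le fun k => ?_
  rw [MeasurableSpace.comap_sup, MeasurableSpace.comap_comp, MeasurableSpace.comap_comp]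
  obtain ⟨k, hk⟩ := k
  refine sup_le (Measurable.comap_le ?_) (Measurable.comap_le ?_)
  · cases k with
    | zero => exact measurable_const
    | succ k => exact measurable_fst.comp (key (k + 1) (by omega))
  · cases k with
    | zero => exact measurable_snd.comp (key 0 (by omega))
    | succ k => exact measurable_snd.comp (key (k + 1) (by omega))

/-! ### The law of the jump process -/

section Law

variable [StandardBorelSpace E] (Q : SemiMarkovKernel E) (x : E)

lemma law_eq_map : law Q x =
    (Kernel.trajMeasure (X := fun _ => ℝ≥0 × E) (Measure.dirac ((0 : ℝ≥0), x)) (step Q)).map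
      toPath := rfl

instance : IsProbabilityMeasure (law Q x) := by
  rw [law_eq_map]
  exact Measure.isProbabilityMeasure_map measurable_toPath.aemeasurable

/-- The Markov property of `(S_n, X_n)` under `ℙ_x`, integrated over an event of `ℱ_n`: given the
past, the pair `(T_{n+1}, X_{n+1})` has law `Q(dt, dy | X_n)`. -/
theorem setLIntegral_law_succ (n : ℕ) {A : Set (Path E)} (hA : MeasurableSet[filtration E n] A)
    {ψ : (ℝ≥0 × E) × (ℝ≥0 × E) → ℝ≥0∞} (hψ : Measurable ψ) :
    ∫⁻ ω in A, ψ ((S n ω, X n ω), (T (n + 1) ω, X (n + 1) ω)) ∂(law Q x) =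
      ∫⁻ ω in A, ∫⁻ z, ψ ((S n ω, X n ω), z) ∂(Q.joint (X n ω)) ∂(law Q x) := by
  have hA' := (filtration E).le n A hA
  have : Nonempty E := ⟨x⟩
  have hSX : Measurable[filtration E n] fun ω : Path E => (S n ω, X n ω) :=
    (measurable_S_filtration n).prodMk (measurable_X_filtration n)
  have hSX0 : Measurable fun ω : Path E => (S n ω, X n ω) := hSX.mono ((filtration E).le n) le_rfl
  obtain ⟨A', hA'm, hA'e⟩ := comap_toPath_filtration_le n _ ⟨A, hA, rfl⟩
  -- `(S_n, X_n)` is a measurable function `f` of the trajectory up to time `n`.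
  have hcomp : Measurable[MeasurableSpace.comap
      (Preorder.frestrictLe (π := fun _ => ℝ≥0 × E) n) inferInstance]
      fun p : ℕ → ℝ≥0 × E => (S n (toPath p), X n (toPath p)) :=
    Measurable.mono (hSX.comp (comap_measurable (m := filtration E n) toPath))
      (comap_toPath_filtration_le n) le_rfl
  obtain ⟨f, hf, hfe⟩ := hcomp.exists_eq_measurable_comp
  have hfe' : ∀ p, (S n (toPath p), X n (toPath p)) =
      f (Preorder.frestrictLe (π := fun _ => ℝ≥0 × E) n p) := fun p => congrFun hfe p
  have hX : ∀ p : ℕ → ℝ≥0 × E, X n (toPath p) =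
      (Preorder.frestrictLe (π := fun _ => ℝ≥0 × E) n p ⟨n, Finset.mem_Iic.2 le_rfl⟩).2 := by
    intro p
    cases n <;> rfl
  have hr : Measurable (Preorder.frestrictLe (π := fun _ => ℝ≥0 × E) n) := by fun_prop
  have hker := Kernel.map_frestrictLe_trajMeasure_compProd_eq_map_trajMeasure
    (X := fun _ => ℝ≥0 × E) (μ₀ := Measure.dirac ((0 : ℝ≥0), x)) (κ := step Q) (a := n)
  set μ := Kernel.trajMeasure (X := fun _ => ℝ≥0 × E) (Measure.dirac ((0 : ℝ≥0), x)) (step Q)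
    with hμ
  have hψ' : Measurable fun q : (Π _ : Finset.Iic n, ℝ≥0 × E) × (ℝ≥0 × E) => ψ (f q.1, q.2) :=
    hψ.comp ((hf.comp measurable_fst).prodMk measurable_snd)
  have hψ0 : Measurable fun ω => ψ ((S n ω, X n ω), (T (n + 1) ω, X (n + 1) ω)) :=
    hψ.comp (hSX0.prodMk ((measurable_T _).prodMk (measurable_X _)))
  -- Both sides are pulled back to trajectories, where `hker` compares them.
  have hL : ∫⁻ ω in A, ψ ((S n ω, X n ω), (T (n + 1) ω, X (n + 1) ω)) ∂(law Q x) =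
      ∫⁻ q in A' ×ˢ univ, ψ (f q.1, q.2) ∂(μ.map
        fun p => (Preorder.frestrictLe (π := fun _ => ℝ≥0 × E) n p, p (n + 1))) := by
    rw [law_eq_map, setLIntegral_map hA' hψ0 measurable_toPath,
      setLIntegral_map (hA'm.prod MeasurableSet.univ) hψ' (by fun_prop), ← hA'e]
    have : (fun p : ℕ → ℝ≥0 × E => (Preorder.frestrictLe (π := fun _ => ℝ≥0 × E) n p, p (n + 1)))
        ⁻¹' A' ×ˢ univ = Preorder.frestrictLe (π := fun _ => ℝ≥0 × E) n ⁻¹' A' := by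
      ext p; simp
    rw [this]
    refine lintegral_congr fun p => ?_
    rw [hfe' p]
    rfl
  have hR : ∫⁻ ω in A, ∫⁻ z, ψ ((S n ω, X n ω), z) ∂(Q.joint (X n ω)) ∂(law Q x) =
      ∫⁻ h in A', ∫⁻ z, ψ (f h, z) ∂(step Q n h)
        ∂(μ.map (Preorder.frestrictLe (π := fun _ => ℝ≥0 × E) n)) := by
    have hm : Measurable fun ω => ∫⁻ z, ψ ((S n ω, X n ω), z) ∂(Q.joint (X n ω)) :=
      (Measurable.lintegral_kernel_prod_right'
        (κ := Q.joint.comap Prod.snd measurable_snd) hψ).comp hSX0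
    rw [law_eq_map, setLIntegral_map hA' hm measurable_toPath,
      setLIntegral_map hA'm (Measurable.lintegral_kernel_prod_right' hψ') hr, ← hA'e]
    refine lintegral_congr fun p => ?_
    rw [hfe' p, hX p]
    rfl
  rw [hL, hR, ← hker, Measure.setLIntegral_compProd hψ' hA'm MeasurableSet.univ]
  simp

lemma law_X_zero : ∀ᵐ ω ∂(law Q x), X 0 ω = x := by
  have hs : MeasurableSet {h : Π _ : Finset.Iic 0, ℝ≥0 × E |
      (h ⟨0, Finset.mem_Iic.2 le_rfl⟩).2 = x} :=
    measurableSet_eq_fun (by fun_prop) measurable_const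
  have hX : MeasurableSet {ω : Path E | X 0 ω = x} :=
    measurableSet_eq_fun (measurable_X 0) measurable_const
  rw [law_eq_map, ae_map_iff measurable_toPath.aemeasurable hX]
  suffices ∀ᵐ h ∂((Kernel.trajMeasure (X := fun _ => ℝ≥0 × E) (Measure.dirac ((0 : ℝ≥0), x))
      (step Q)).map (Preorder.frestrictLe (π := fun _ => ℝ≥0 × E) 0)),
      (h ⟨0, Finset.mem_Iic.2 le_rfl⟩).2 = x from
    (ae_map_iff (by fun_prop) hs).1 this
  -- The restriction of the trajectory to time `0` still has the initial law.
  rw [Kernel.trajMeasure, Measure.map_comp _ _ (by fun_prop), Kernel.traj_map_frestrictLe,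
    Kernel.partialTraj_self, Measure.id_comp]
  refine (ae_map_iff (MeasurableEquiv.measurable _).aemeasurable hs).2 ?_
  exact (ae_dirac_iff (MeasurableEquiv.measurable _ hs)).2 rfl

/-- Sojourn times are almost surely positive, because `Q(0, E | y) = 0`. -/
lemma law_T_succ_pos : ∀ᵐ ω ∂(law Q x), ∀ n, 0 < T (n + 1) ω := by
  refine ae_all_iff.2 fun n => ?_
  have h := setLIntegral_law_succ Q x n MeasurableSet.univ
    (ψ := fun q => (Iic (0 : ℝ≥0) ×ˢ univ).indicator 1 q.2)
    ((measurable_one.indicator (measurableSet_Iic.prod MeasurableSet.univ)).comp measurable_snd)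
  have h0 : ∀ y, Q.joint y (Iic (0 : ℝ≥0) ×ˢ univ) = 0 := fun y => by
    rw [Q.joint_apply 0 y MeasurableSet.univ, Q.zero y _ MeasurableSet.univ]
  simp only [lintegral_indicator_one (measurableSet_Iic.prod MeasurableSet.univ), h0,
    lintegral_zero] at h
  have hm : Measurable fun ω : Path E =>
      (Iic (0 : ℝ≥0) ×ˢ univ).indicator (1 : ℝ≥0 × E → ℝ≥0∞) (T (n + 1) ω, X (n + 1) ω) :=
    (measurable_one.indicator (measurableSet_Iic.prod MeasurableSet.univ)).comp
      ((measurable_T (n + 1)).prodMk (measurable_X (n + 1)))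
  rw [setLIntegral_univ, lintegral_eq_zero_iff hm] at h
  filter_upwards [h] with ω hω
  by_contra hT
  simp [not_lt.1 hT, indicator] at hω

/-- Under the regularity assumption the Laplace transform of the sojourn time at `1` is bounded away
from `1`, uniformly in the present state. -/
lemma exists_laplace_lt_one {Q : SemiMarkovKernel E} (hQ : Q.Regular) :
    ∃ ρ : ℝ≥0∞, ρ < 1 ∧ ∀ y,
      ∫⁻ z, ENNReal.ofReal (Real.exp (-(z.1 : ℝ))) ∂(Q.joint y) ≤ ρ := by
  obtain ⟨δ, hδ, ε, hε, h⟩ := hQ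
  set e : ℝ := Real.exp (-(δ : ℝ)) with he
  have he1 : e < 1 := Real.exp_lt_one_iff.2 (neg_lt_zero.2 hδ)
  have he0 : 0 < e := Real.exp_pos _
  set q : ℝ := max (1 - ε) 0 with hq
  have hq1 : q < 1 := max_lt (by linarith) one_pos
  have hq0 : 0 ≤ q := le_max_right _ _
  refine ⟨ENNReal.ofReal (e + (1 - e) * q), ?_, fun y => ?_⟩
  · rw [ENNReal.ofReal_lt_one]
    nlinarith
  -- Split according to whether the sojourn time exceeds `δ`.
  have hpt : ∀ z : ℝ≥0 × E, ENNReal.ofReal (Real.exp (-(z.1 : ℝ))) ≤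
      ENNReal.ofReal e + ENNReal.ofReal (1 - e) * (Iic δ ×ˢ univ).indicator 1 z := by
    intro z
    by_cases hz : z.1 ≤ δ
    · have : z ∈ Iic δ ×ˢ (univ : Set E) := ⟨hz, trivial⟩
      rw [indicator_of_mem this, Pi.one_apply, mul_one, ← ENNReal.ofReal_add he0.le (by linarith)]
      exact ENNReal.ofReal_le_ofReal (by simp)
    · refine le_add_right (ENNReal.ofReal_le_ofReal (Real.exp_le_exp.2 (neg_le_neg ?_)))
      exact_mod_cast (not_le.1 hz).le
  have hm : MeasurableSet (Iic δ ×ˢ (univ : Set E)) := measurableSet_Iic.prod MeasurableSet.univ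
  calc _ ≤ ∫⁻ z, (ENNReal.ofReal e + ENNReal.ofReal (1 - e) * (Iic δ ×ˢ univ).indicator 1 z)
        ∂(Q.joint y) := lintegral_mono hpt
    _ = ENNReal.ofReal e + ENNReal.ofReal (1 - e) * Q.ker δ y univ := by
        rw [lintegral_add_left measurable_const, lintegral_const_mul _ (measurable_one.indicator hm),
          lintegral_indicator_one hm, Q.joint_apply δ y MeasurableSet.univ]
        simp
    _ ≤ ENNReal.ofReal e + ENNReal.ofReal (1 - e) * ENNReal.ofReal q := by
        gcongr
        rw [← ofReal_measureReal (measure_ne_top _ _)]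
        exact ENNReal.ofReal_le_ofReal ((h y).trans (le_max_left _ _))
    _ = _ := by
        rw [← ENNReal.ofReal_mul (by linarith), ← ENNReal.ofReal_add he0.le
          (mul_nonneg (by linarith) hq0)]

lemma lintegral_exp_neg_S_le {ρ : ℝ≥0∞}
    (hρ : ∀ y, ∫⁻ z, ENNReal.ofReal (Real.exp (-(z.1 : ℝ))) ∂(Q.joint y) ≤ ρ) (n : ℕ) :
    ∫⁻ ω, ENNReal.ofReal (Real.exp (-(S n ω : ℝ))) ∂(law Q x) ≤ ρ ^ n := by
  induction n with
  | zero => simp [S_zero]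
  | succ n ih =>
    have h := setLIntegral_law_succ Q x n MeasurableSet.univ
      (ψ := fun q => ENNReal.ofReal (Real.exp (-(q.1.1 : ℝ))) *
        ENNReal.ofReal (Real.exp (-(q.2.1 : ℝ)))) (by fun_prop)
    simp only [setLIntegral_univ] at h
    have hS : ∀ ω : Path E, ENNReal.ofReal (Real.exp (-(S (n + 1) ω : ℝ))) =
        ENNReal.ofReal (Real.exp (-(S n ω : ℝ))) *
          ENNReal.ofReal (Real.exp (-(T (n + 1) ω : ℝ))) := fun ω => by
      rw [← ENNReal.ofReal_mul (Real.exp_pos _).le, ← Real.exp_add, S_succ, NNReal.coe_add,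
        neg_add]
    simp_rw [hS]
    rw [h, pow_succ]
    calc _ ≤ ∫⁻ ω, ENNReal.ofReal (Real.exp (-(S n ω : ℝ))) * ρ ∂(law Q x) := by
          refine lintegral_mono fun ω => ?_
          dsimp only
          rw [lintegral_const_mul _ (by fun_prop)]
          gcongr
          exact hρ _
      _ ≤ ρ ^ n * ρ := by
          have := measurable_S (E := E) n
          rw [lintegral_mul_const _ (by fun_prop)]
          gcongr

/-- The process does not explode: almost surely `lim S_n = ∞`. -/
theorem law_S_unbounded {Q : SemiMarkovKernel E} (hQ : Q.Regular) (x : E) :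
    ∀ᵐ ω ∂(law Q x), ∀ M : ℝ≥0, ∃ n, M < S n ω := by
  obtain ⟨ρ, hρ1, hρ⟩ := exists_laplace_lt_one hQ
  have key : ∀ M : ℕ, ∀ᵐ ω ∂(law Q x), ∃ n, (M : ℝ≥0) < S n ω := by
    intro M
    rw [ae_iff]
    simp only [not_exists, not_lt]
    -- Markov's inequality for `exp (-S_n)`, which is at least `a` where `S_n ≤ M`.
    set a : ℝ≥0∞ := ENNReal.ofReal (Real.exp (-(M : ℝ))) with ha
    have ha0 : a ≠ 0 := by simp [ha, Real.exp_pos]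
    have hle : ∀ n, law Q x {ω | ∀ n, S n ω ≤ M} ≤ ρ ^ n / a := by
      intro n
      rw [ENNReal.le_div_iff_mul_le (Or.inl ha0) (Or.inl ENNReal.ofReal_ne_top), mul_comm]
      have hSm := measurable_S (E := E) n
      refine le_trans ?_ (lintegral_exp_neg_S_le Q x hρ n)
      refine le_trans ?_ (mul_meas_ge_le_lintegral
        (f := fun ω => ENNReal.ofReal (Real.exp (-(S n ω : ℝ)))) (by fun_prop) a)
      gcongr with ω
      intro hω
      have := hω n
      change a ≤ _
      rw [ha]
      gcongr
      exact_mod_cast this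
    have hlim : Tendsto (fun n => ρ ^ n / a) atTop (𝓝 0) := by
      have := ENNReal.Tendsto.div_const (ENNReal.tendsto_pow_atTop_nhds_zero_of_lt_one hρ1)
        (Or.inr ha0)
      simpa using this
    exact le_antisymm (ge_of_tendsto' hlim hle) zero_le
  filter_upwards [ae_all_iff.2 key] with ω hω M
  obtain ⟨m, hm⟩ := exists_nat_gt M
  obtain ⟨n, hn⟩ := hω m
  exact ⟨n, hm.trans hn⟩

end Law

/-! ### The cost along a path -/

/-- The state of the controlled chain after `n` jumps: the time `s - S_n` left until the horizon
(`0` once the horizon is reached), and the state `X_n`. -/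
def remaining (s : ℝ≥0) (n : ℕ) (ω : Path E) : ℝ≥0 × E := (s - S n ω, X n ω)

/-- The running cost between the `n`-th and the `(n+1)`-th jump, cut off at the horizon `s`. -/
def runCost (c : E → ℝ≥0) (s : ℝ≥0) (n : ℕ) (ω : Path E) : ℝ≥0∞ :=
  (c (X n ω) * min (T (n + 1) ω) (s - S n ω) : ℝ≥0)

/-- The cost of stopping with remaining time `y.1` in state `y.2`: it is `g` before the horizon, and
`0` at the horizon. -/
def stopCost (g : E → ℝ≥0) (y : ℝ≥0 × E) : ℝ≥0∞ := if y.1 = 0 then 0 else g y.2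

section Pathwise

variable {ω : Path E}

omit [MeasurableSpace E] in
lemma strictMono_S (hpos : ∀ n, 0 < T (n + 1) ω) : StrictMono fun n => S n ω :=
  strictMono_nat_of_lt_succ fun n => by
    rw [S_succ]; exact lt_add_of_pos_right _ (hpos n)

omit [MeasurableSpace E] in
/-- Positivity of the sojourn times makes `X(S_n) = X_n`. -/
lemma process_eq_some (hpos : ∀ n, 0 < T (n + 1) ω) {k : ℕ} {t : ℝ} (h1 : (S k ω : ℝ) ≤ t)
    (h2 : t < S (k + 1) ω) : process ω t = some (X k ω) := by
  have hS := (strictMono_S hpos).monotone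
  have h : ∃ n, (S n ω : ℝ) ≤ t ∧ t < S (n + 1) ω := ⟨k, h1, h2⟩
  classical
  have huniq : ∀ n, (S n ω : ℝ) ≤ t → t < S (n + 1) ω → n = k := by
    intro n hn1 hn2
    rcases lt_trichotomy n k with hlt | heq | hlt
    · have : (S (n + 1) ω : ℝ) ≤ S k ω := by exact_mod_cast hS hlt
      linarith
    · exact heq
    · have : (S (k + 1) ω : ℝ) ≤ S n ω := by exact_mod_cast hS hlt
      linarith
  rw [process, dif_pos h]
  congr 2
  exact huniq _ (Nat.find_spec h).1 (Nat.find_spec h).2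

omit [MeasurableSpace E] in
/-- Along a path that does not explode, the accumulated running cost is the sum over the sojourn
intervals. -/
lemma lintegral_process (c : E → ℝ≥0) (hpos : ∀ n, 0 < T (n + 1) ω)
    (hunb : ∀ M : ℝ≥0, ∃ n, M < S n ω) (s : ℝ≥0) :
    ∫⁻ t in Ioc 0 (s : ℝ), extendZero c (process ω t) = ∑' n, runCost c s n ω := by
  have hS := (strictMono_S hpos).monotone
  have hSr : Monotone fun n => (S n ω : ℝ) := fun m n h => by exact_mod_cast hS h
  have hU : Ico 0 (s : ℝ) = ⋃ n, Ico (S n ω : ℝ) (min (S (n + 1) ω : ℝ) s) := by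
    ext t
    simp only [mem_iUnion, mem_Ico, lt_min_iff]
    refine ⟨fun ⟨h0, hs⟩ => ?_, fun ⟨n, h1, _, h2⟩ => ⟨(S n ω).coe_nonneg.trans h1, h2⟩⟩
    have hex : ∃ n, t < S n ω := by
      obtain ⟨n, hn⟩ := hunb ⟨t, h0⟩
      exact ⟨n, hn⟩
    classical
    -- The first jump after `t` is not the one at time `0`.
    obtain ⟨k, hk⟩ : ∃ k, Nat.find hex = k + 1 := by
      refine Nat.exists_eq_succ_of_ne_zero fun h => ?_
      have := Nat.find_spec hex
      rw [h, S_zero] at this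
      exact absurd this (not_lt.2 h0)
    refine ⟨k, not_lt.1 (Nat.find_min hex (by omega)), ?_, hs⟩
    rw [← hk]
    exact Nat.find_spec hex
  have hd : Pairwise (Function.onFun Disjoint
      fun n => Ico (S n ω : ℝ) (min (S (n + 1) ω : ℝ) s)) := fun m n hmn =>
    (hSr.pairwise_disjoint_on_Ico_succ hmn).mono (Ico_subset_Ico_right (min_le_left _ _))
      (Ico_subset_Ico_right (min_le_left _ _))
  rw [Measure.restrict_congr_set Ico_ae_eq_Ioc.symm, hU,
    lintegral_iUnion (fun _ => measurableSet_Ico) hd]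
  refine tsum_congr fun n => ?_
  rw [setLIntegral_congr_fun (g := fun _ => (c (X n ω) : ℝ≥0∞)) measurableSet_Ico
    fun t ht => ?_]
  · rw [setLIntegral_const, Real.volume_Ico, runCost, ENNReal.coe_mul]
    congr 1
    rw [ENNReal.ofReal, ENNReal.coe_inj, ← NNReal.coe_min, ← NNReal.sub_def, S_succ]
    have hmin : Monotone fun a => a - S n ω := fun _ _ h => tsub_le_tsub_right h _
    exact (hmin.map_min).trans (by simp)
  · dsimp only
    rw [process_eq_some hpos ht.1 (ht.2.trans_le (min_le_left _ _))]
    rfl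

omit [MeasurableSpace E] in
lemma runCost_eq_zero {c : E → ℝ≥0} {s : ℝ≥0} {n : ℕ} (h : s ≤ S n ω) : runCost c s n ω = 0 := by
  simp [runCost, tsub_eq_zero_of_le h]

omit [MeasurableSpace E] in
/-- Along a path that does not explode, the cost of stopping splits into the running costs of the
sojourn intervals before `τ`, and the terminal cost at `τ`. -/
lemma cost_eq_tsum (c g : E → ℝ≥0) (hpos : ∀ n, 0 < T (n + 1) ω)
    (hunb : ∀ M : ℝ≥0, ∃ n, M < S n ω) (s : ℝ≥0) (τ : Path E → WithTop ℕ) :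
    cost c g s τ ω = ∑' n : ℕ, ({ω | (n : WithTop ℕ) < τ ω}.indicator (runCost c s n) ω +
      {ω | τ ω = n}.indicator (fun ω => stopCost g (remaining s n ω)) ω) := by
  have hS := strictMono_S hpos
  rw [ENNReal.tsum_add, cost]
  cases hτ : τ ω with
  | top =>
    have h1 : ¬ jumpTime ⊤ ω < s := by
      rw [not_lt]
      obtain ⟨n, hn⟩ := hunb s
      exact le_trans (by exact_mod_cast hn.le) (le_iSup (fun n => (S n ω : ℝ≥0∞)) n)
    rw [if_neg h1, lintegral_process c hpos hunb s]
    simp [indicator, hτ]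
  | coe m =>
    have h2 : ∑' n : ℕ, {ω | τ ω = n}.indicator (fun ω => stopCost g (remaining s n ω)) ω =
        stopCost g (remaining s m ω) := by
      rw [tsum_eq_single m]
      · simp [hτ]
      · intro n hn
        have : ¬ m = n := fun h => hn h.symm
        simp [hτ, this]
    have h3 : ∀ n : ℕ, {ω | (n : WithTop ℕ) < τ ω}.indicator (runCost c s n) ω =
        if n < m then runCost c s n ω else 0 := by
      intro n
      simp [indicator, hτ]
    rw [h2]
    simp_rw [h3]
    have hj : jumpTime (WithTop.some m) ω = (S m ω : ℝ≥0∞) := rfl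
    rw [hj]
    by_cases hm : S m ω < s
    · rw [if_pos (by exact_mod_cast hm), ENNReal.coe_toReal, lintegral_process c hpos hunb,
        process_eq_some hpos le_rfl (by exact_mod_cast hS (Nat.lt_succ_self m))]
      congr 1
      · refine tsum_congr fun n => ?_
        split_ifs with hn
        · -- An interval that ends before `S_m` is cut off neither at `S_m` nor at `s`.
          have h4 : S n ω + T (n + 1) ω ≤ S m ω := by
            rw [← S_succ]; exact hS.monotone hn
          have h5 : T (n + 1) ω ≤ S m ω - S n ω := le_tsub_of_add_le_left h4
          rw [runCost, runCost, min_eq_left h5,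
            min_eq_left (h5.trans (tsub_le_tsub_right hm.le _))]
        · exact runCost_eq_zero (hS.monotone (not_lt.1 hn))
      · simp [extendZero, stopCost, remaining, tsub_eq_zero_iff_le, hm]
    · rw [if_neg (by exact_mod_cast hm), lintegral_process c hpos hunb]
      have h6 : stopCost g (remaining s m ω) = 0 := by
        simp [stopCost, remaining, tsub_eq_zero_of_le (not_lt.1 hm)]
      rw [h6, add_zero]
      refine tsum_congr fun n => ?_
      split_ifs with hn
      · rfl
      · exact runCost_eq_zero ((not_lt.1 hm).trans (hS.monotone (not_lt.1 hn)))

end Pathwise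

/-! ### Value iteration -/

lemma measurable_remaining_filtration (s : ℝ≥0) (n : ℕ) :
    Measurable[filtration E n] (remaining s n : Path E → ℝ≥0 × E) :=
  ((measurable_S_filtration n).const_sub s).prodMk (measurable_X_filtration n)

lemma measurable_remaining (s : ℝ≥0) (n : ℕ) :
    Measurable (remaining s n : Path E → ℝ≥0 × E) :=
  (measurable_remaining_filtration s n).mono ((filtration E).le n) le_rfl

lemma measurable_runCost {c : E → ℝ≥0} (hc : Measurable c) (s : ℝ≥0) (n : ℕ) :
    Measurable (runCost c s n : Path E → ℝ≥0∞) :=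
  ((hc.comp (measurable_X n)).mul
    ((measurable_T (n + 1)).min ((measurable_S n).const_sub s))).coe_nnreal_ennreal

lemma measurable_stopCost {g : E → ℝ≥0} (hg : Measurable g) : Measurable (stopCost g) :=
  Measurable.ite (measurable_fst (measurableSet_singleton 0)) measurable_const
    (hg.comp measurable_snd).coe_nnreal_ennreal

variable [StandardBorelSpace E] (Q : SemiMarkovKernel E) (c g : E → ℝ≥0)

/-- The expected cost of waiting for one more jump with remaining time `y.1` in state `y.2`, if
every later state of the chain is charged with `u`. -/
def waitCost (u : ℝ≥0 × E → ℝ≥0∞) (y : ℝ≥0 × E) : ℝ≥0∞ :=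
  ∫⁻ z, ((c y.2 * min z.1 y.1 : ℝ≥0) + u (y.1 - z.1, z.2)) ∂(Q.joint y.2)

/-- Value iteration: the least expected cost if the process is left without terminal cost after `n`
jumps. -/
def valueIter : ℕ → ℝ≥0 × E → ℝ≥0∞
  | 0, _ => 0
  | n + 1, y => min (stopCost g y) (waitCost Q c (valueIter n) y)

/-- The limit of value iteration. By `value_eq_iterLimit` it is the value function. -/
def iterLimit (y : ℝ≥0 × E) : ℝ≥0∞ := ⨆ n, valueIter Q c g n y

variable {c g}

lemma measurable_waitCost (hc : Measurable c) {u : ℝ≥0 × E → ℝ≥0∞} (hu : Measurable u) :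
    Measurable (waitCost Q c u) :=
  Measurable.lintegral_kernel_prod_right' (κ := Q.joint.comap Prod.snd measurable_snd)
    (f := fun q : (ℝ≥0 × E) × (ℝ≥0 × E) =>
      ((c q.1.2 * min q.2.1 q.1.1 : ℝ≥0) + u (q.1.1 - q.2.1, q.2.2) : ℝ≥0∞)) (by fun_prop)

lemma measurable_valueIter (hc : Measurable c) (hg : Measurable g) (n : ℕ) :
    Measurable (valueIter Q c g n) := by
  induction n with
  | zero => exact measurable_const
  | succ n ih => exact (measurable_stopCost hg).min (measurable_waitCost Q hc ih)

lemma measurable_iterLimit (hc : Measurable c) (hg : Measurable g) :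
    Measurable (iterLimit Q c g) :=
  Measurable.iSup fun n => measurable_valueIter Q hc hg n

lemma waitCost_mono {u v : ℝ≥0 × E → ℝ≥0∞} (h : u ≤ v) : waitCost Q c u ≤ waitCost Q c v :=
  fun _ => lintegral_mono fun _ => add_le_add_right (h _) _

lemma monotone_valueIter : Monotone (valueIter Q c g) := by
  refine monotone_nat_of_le_succ fun n => ?_
  induction n with
  | zero => exact fun _ => zero_le
  | succ n ih => exact fun y => min_le_min_left _ (waitCost_mono Q ih y)

lemma waitCost_iterLimit (hc : Measurable c) (hg : Measurable g) (y : ℝ≥0 × E) :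
    waitCost Q c (iterLimit Q c g) y = ⨆ n, waitCost Q c (valueIter Q c g n) y := by
  have hm := measurable_valueIter Q hc hg
  simp only [waitCost, iterLimit, ENNReal.add_iSup]
  refine lintegral_iSup (fun n => ?_) fun m n hmn z =>
    add_le_add_right (monotone_valueIter Q hmn _) _
  have := hm n
  fun_prop

/-- The optimality equation. -/
lemma iterLimit_eq_min (hc : Measurable c) (hg : Measurable g) (y : ℝ≥0 × E) :
    iterLimit Q c g y = min (stopCost g y) (waitCost Q c (iterLimit Q c g) y) := by
  rw [waitCost_iterLimit Q hc hg, inf_iSup_eq]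
  refine le_antisymm (iSup_le fun n => ?_)
    (iSup_le fun n => le_iSup (fun n => valueIter Q c g n y) (n + 1))
  exact (monotone_valueIter Q n.le_succ y).trans
    (le_iSup (fun n => stopCost g y ⊓ waitCost Q c (valueIter Q c g n) y) n)

/-- Waiting at time `n` on an event of `ℱ_n`, in terms of the chain. -/
lemma setLIntegral_waitCost (hc : Measurable c) {u : ℝ≥0 × E → ℝ≥0∞} (hu : Measurable u)
    (s : ℝ≥0) (x : E) (n : ℕ) {A : Set (Path E)} (hA : MeasurableSet[filtration E n] A) :
    ∫⁻ ω in A, waitCost Q c u (remaining s n ω) ∂(law Q x) =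
      ∫⁻ ω in A, runCost c s n ω ∂(law Q x) +
        ∫⁻ ω in A, u (remaining s (n + 1) ω) ∂(law Q x) := by
  rw [← lintegral_add_left (measurable_runCost hc s n)]
  refine (setLIntegral_law_succ Q x n hA (ψ := fun q =>
    ((c q.1.2 * min q.2.1 (s - q.1.1) : ℝ≥0) + u (s - q.1.1 - q.2.1, q.2.2)))
      (by fun_prop)).symm.trans (lintegral_congr fun ω => ?_)
  simp only [runCost, remaining, S_succ, tsub_tsub]

/-! ### The expected cost of a stopping time -/

/-- The expected contribution of the `n`-th stage to the cost of `τ`: the running cost up to the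
next jump if `τ > n`, the terminal cost if `τ = n`. -/
def stageCost (c g : E → ℝ≥0) (s : ℝ≥0) (τ : Path E → WithTop ℕ) (x : E) (n : ℕ) : ℝ≥0∞ :=
  ∫⁻ ω in {ω | (n : WithTop ℕ) < τ ω}, runCost c s n ω ∂(law Q x) +
    ∫⁻ ω in {ω | τ ω = n}, stopCost g (remaining s n ω) ∂(law Q x)

variable {Q} {τ : Path E → WithTop ℕ}

omit [StandardBorelSpace E] in
lemma measurableSet_eq_filtration (hτ : IsStoppingTime (filtration E) τ) (n : ℕ) :
    MeasurableSet[filtration E n] {ω | τ ω = n} := hτ.measurableSet_eq n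

omit [StandardBorelSpace E] in
lemma measurableSet_lt_filtration (hτ : IsStoppingTime (filtration E) τ) (n : ℕ) :
    MeasurableSet[filtration E n] {ω | (n : WithTop ℕ) < τ ω} := hτ.measurableSet_gt n

lemma expectedCost_eq_tsum (hQ : Q.Regular) (hc : Measurable c) (hg : Measurable g)
    (hτ : IsStoppingTime (filtration E) τ) (s : ℝ≥0) (x : E) :
    expectedCost Q c g τ s x = ∑' n, stageCost Q c g s τ x n := by
  have hlt := fun n => (filtration E).le n _ (measurableSet_lt_filtration hτ n)
  have heq := fun n => (filtration E).le n _ (measurableSet_eq_filtration hτ n)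
  have hrun := fun n => (measurable_runCost hc s n).indicator (hlt n)
  have hterm := fun n => ((measurable_stopCost hg).comp (measurable_remaining s n)).indicator
    (heq n)
  have : ∀ᵐ ω ∂(law Q x), cost c g s τ ω =
      ∑' n : ℕ, ({ω | (n : WithTop ℕ) < τ ω}.indicator (runCost c s n) ω +
        {ω | τ ω = n}.indicator (fun ω => stopCost g (remaining s n ω)) ω) := by
    filter_upwards [law_T_succ_pos Q x, law_S_unbounded hQ x] with ω hpos hunb
    exact cost_eq_tsum c g hpos hunb s τ
  rw [expectedCost, lintegral_congr_ae this,
    lintegral_tsum fun n => ?_]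
  · refine tsum_congr fun n => ?_
    rw [lintegral_add_left (hrun n), lintegral_indicator (hlt n), lintegral_indicator (heq n)]
    rfl
  · exact ((hrun n).add (hterm n)).aemeasurable

/-- The event `τ ≥ n` splits into stopping at `n` and waiting for the next jump. -/
lemma setLIntegral_le_eq_add (hτ : IsStoppingTime (filtration E) τ) (x : E) (n : ℕ)
    (f : Path E → ℝ≥0∞) :
    ∫⁻ ω in {ω | (n : WithTop ℕ) ≤ τ ω}, f ω ∂(law Q x) =
      ∫⁻ ω in {ω | τ ω = n}, f ω ∂(law Q x) +
        ∫⁻ ω in {ω | (n : WithTop ℕ) < τ ω}, f ω ∂(law Q x) := by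
  rw [← lintegral_union ((filtration E).le n _ (measurableSet_lt_filtration hτ n))]
  · congr 2
    ext ω
    simp [le_iff_eq_or_lt, eq_comm]
  · exact disjoint_left.2 fun ω h1 h2 => h2.ne' h1

omit [MeasurableSpace E] [StandardBorelSpace E] in
lemma setOf_natCast_lt_eq (τ : Path E → WithTop ℕ) (n : ℕ) :
    {ω | (n : WithTop ℕ) < τ ω} = {ω | ((n + 1 : ℕ) : WithTop ℕ) ≤ τ ω} := by
  ext ω
  simp only [mem_ofPred_eq]
  cases τ ω with
  | top => simp
  | coe m =>
    change (WithTop.some n < WithTop.some m) ↔ WithTop.some (n + 1) ≤ WithTop.some m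
    rw [WithTop.coe_lt_coe, WithTop.coe_le_coe, Nat.lt_iff_add_one_le]

/-- No stopping time beats `m` steps of value iteration over its next `m` stages. -/
lemma setLIntegral_valueIter_le (hc : Measurable c) (hg : Measurable g)
    (hτ : IsStoppingTime (filtration E) τ) (s : ℝ≥0) (x : E) (m n : ℕ) :
    ∫⁻ ω in {ω | (n : WithTop ℕ) ≤ τ ω}, valueIter Q c g m (remaining s n ω) ∂(law Q x) ≤
      ∑ k ∈ Finset.range m, stageCost Q c g s τ x (n + k) := by
  induction m generalizing n with
  | zero => simp [valueIter]
  | succ m ih =>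
    rw [setLIntegral_le_eq_add hτ, Finset.sum_range_succ', add_zero]
    calc _ ≤ ∫⁻ ω in {ω | τ ω = n}, stopCost g (remaining s n ω) ∂(law Q x) +
          ∫⁻ ω in {ω | (n : WithTop ℕ) < τ ω},
            waitCost Q c (valueIter Q c g m) (remaining s n ω) ∂(law Q x) :=
          add_le_add (lintegral_mono fun ω => min_le_left _ _)
            (lintegral_mono fun ω => min_le_right _ _)
      _ = ∫⁻ ω in {ω | ((n + 1 : ℕ) : WithTop ℕ) ≤ τ ω},
            valueIter Q c g m (remaining s (n + 1) ω) ∂(law Q x) + stageCost Q c g s τ x n := by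
          rw [setLIntegral_waitCost Q hc (measurable_valueIter Q hc hg m) s x n
            (measurableSet_lt_filtration hτ n), stageCost, setOf_natCast_lt_eq]
          ring
      _ ≤ _ := by
          gcongr
          refine (ih (n + 1)).trans (le_of_eq (Finset.sum_congr rfl fun k _ => ?_))
          congr 1
          ring

lemma setLIntegral_remaining_zero (τ : Path E → WithTop ℕ) (u : ℝ≥0 × E → ℝ≥0∞) (s : ℝ≥0) (x : E) :
    ∫⁻ ω in {ω | ((0 : ℕ) : WithTop ℕ) ≤ τ ω}, u (remaining s 0 ω) ∂(law Q x) = u (s, x) := by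
  have h : {ω | ((0 : ℕ) : WithTop ℕ) ≤ τ ω} = univ := by simp
  rw [h, setLIntegral_univ, lintegral_congr_ae (g := fun _ => u (s, x))]
  · simp
  · filter_upwards [law_X_zero Q x] with ω hω
    simp [remaining, hω, S_zero]

/-- The limit of value iteration is a lower bound for the cost of every stopping time. -/
lemma iterLimit_le_expectedCost (hQ : Q.Regular) (hc : Measurable c) (hg : Measurable g)
    (hτ : IsStoppingTime (filtration E) τ) (s : ℝ≥0) (x : E) :
    iterLimit Q c g (s, x) ≤ expectedCost Q c g τ s x := by
  rw [expectedCost_eq_tsum hQ hc hg hτ]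
  refine iSup_le fun m => ?_
  rw [← setLIntegral_remaining_zero τ (valueIter Q c g m) s x]
  refine (setLIntegral_valueIter_le hc hg hτ s x m 0).trans ?_
  simpa using ENNReal.sum_le_tsum (f := stageCost Q c g s τ x) (Finset.range m)

/-! ### The optimal stopping time -/

lemma iInf_natCast_le_iff {p : ℕ → Prop} {m : ℕ} :
    (⨅ (n : ℕ) (_ : p n), (n : WithTop ℕ)) ≤ m ↔ ∃ k ≤ m, p k := by
  refine ⟨fun h => ?_, fun ⟨k, hk, hp⟩ => (iInf₂_le k hp).trans (by exact_mod_cast hk)⟩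
  by_contra! hcon
  have h1 : ((m + 1 : ℕ) : WithTop ℕ) ≤ ⨅ (n : ℕ) (_ : p n), (n : WithTop ℕ) := by
    refine le_iInf₂ fun n hn => ?_
    have : m < n := not_le.1 fun hnm => hcon n hnm hn
    exact_mod_cast this
  have h2 : m + 1 ≤ m := by exact_mod_cast h1.trans h
  omega

variable (Q c g) in
/-- The first stage at which stopping is optimal according to the optimality equation. -/
def hitTime (s : ℝ≥0) (ω : Path E) : WithTop ℕ :=
  ⨅ (n : ℕ) (_ : iterLimit Q c g (remaining s n ω) = stopCost g (remaining s n ω)),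
    (n : WithTop ℕ)

lemma isStoppingTime_hitTime (hc : Measurable c) (hg : Measurable g) (s : ℝ≥0) :
    IsStoppingTime (filtration E) (hitTime Q c g s) := by
  intro n
  have : {ω | hitTime Q c g s ω ≤ n} =
      ⋃ (k : ℕ) (_ : k ≤ n), remaining s k ⁻¹' {y | iterLimit Q c g y = stopCost g y} := by
    ext ω
    simp only [mem_ofPred_eq, hitTime, mem_iUnion, mem_preimage, exists_prop]
    exact iInf_natCast_le_iff
  change MeasurableSet[filtration E n] {ω | hitTime Q c g s ω ≤ n}
  rw [this]
  refine MeasurableSet.iUnion fun k => MeasurableSet.iUnion fun hk => ?_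
  exact (filtration E).mono hk _ (measurable_remaining_filtration s k
    (measurableSet_eq_fun (measurable_iterLimit Q hc hg) (measurable_stopCost hg)))

lemma iterLimit_eq_of_hitTime_eq {s : ℝ≥0} {n : ℕ} {ω : Path E} (h : hitTime Q c g s ω = n) :
    iterLimit Q c g (remaining s n ω) = stopCost g (remaining s n ω) := by
  obtain ⟨k, hk, hp⟩ := iInf_natCast_le_iff.1 h.le
  have h2 : hitTime Q c g s ω ≤ k := iInf_natCast_le_iff.2 ⟨k, le_rfl, hp⟩
  rw [h] at h2
  have h3 : n ≤ k := by exact_mod_cast h2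
  rwa [le_antisymm h3 hk]

lemma iterLimit_eq_of_lt_hitTime (hc : Measurable c) (hg : Measurable g) {s : ℝ≥0} {n : ℕ}
    {ω : Path E} (h : n < hitTime Q c g s ω) :
    iterLimit Q c g (remaining s n ω) = waitCost Q c (iterLimit Q c g) (remaining s n ω) := by
  have h1 : iterLimit Q c g (remaining s n ω) ≠ stopCost g (remaining s n ω) := fun he =>
    h.not_ge (iInf_natCast_le_iff.2 ⟨n, le_rfl, he⟩)
  rw [iterLimit_eq_min Q hc hg] at h1 ⊢
  exact (min_choice _ _).resolve_left h1

/-- Until `hitTime`, the accumulated cost together with the limit of value iteration at the present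
state is conserved in mean. -/
lemma sum_stageCost_hitTime_add (hc : Measurable c) (hg : Measurable g) (s : ℝ≥0) (x : E)
    (n : ℕ) :
    ∑ k ∈ Finset.range n, stageCost Q c g s (hitTime Q c g s) x k +
      ∫⁻ ω in {ω | (n : WithTop ℕ) ≤ hitTime Q c g s ω},
        iterLimit Q c g (remaining s n ω) ∂(law Q x) = iterLimit Q c g (s, x) := by
  have hτ := isStoppingTime_hitTime (Q := Q) hc hg s
  induction n with
  | zero => simpa using setLIntegral_remaining_zero (hitTime Q c g s) _ s x
  | succ n ih =>
    have hlt := measurableSet_lt_filtration hτ n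
    rw [← ih, setLIntegral_le_eq_add hτ x n, Finset.sum_range_succ,
      setLIntegral_congr_fun ((filtration E).le n _ hlt)
        (fun ω h => iterLimit_eq_of_lt_hitTime hc hg h),
      setLIntegral_congr_fun ((filtration E).le n _ (measurableSet_eq_filtration hτ n))
        (fun ω h => iterLimit_eq_of_hitTime_eq h),
      setLIntegral_waitCost Q hc (measurable_iterLimit Q hc hg) s x n hlt, stageCost,
      ← setOf_natCast_lt_eq]
    ring

/-- The mean conserved by `sum_stageCost_hitTime_add` bounds the cost collected by every stage. -/
lemma expectedCost_hitTime_le (hQ : Q.Regular) (hc : Measurable c) (hg : Measurable g) (s : ℝ≥0)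
    (x : E) : expectedCost Q c g (hitTime Q c g s) s x ≤ iterLimit Q c g (s, x) := by
  rw [expectedCost_eq_tsum hQ hc hg (isStoppingTime_hitTime hc hg s), ENNReal.tsum_eq_iSup_nat]
  exact iSup_le fun n => le_self_add.trans (sum_stageCost_hitTime_add hc hg s x n).le

theorem value_eq_iterLimit (hQ : Q.Regular) (hc : Measurable c) (hg : Measurable g) (s : ℝ≥0)
    (x : E) : value Q c g s x = iterLimit Q c g (s, x) :=
  le_antisymm ((iInf₂_le _ (isStoppingTime_hitTime hc hg s)).trans
    (expectedCost_hitTime_le hQ hc hg s x))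
    (le_iInf₂ fun _ hτ => iterLimit_le_expectedCost hQ hc hg hτ s x)

lemma optimalTime_eq_hitTime (hQ : Q.Regular) (hc : Measurable c) (hg : Measurable g) (H : ℝ≥0) :
    optimalTime Q c g H = hitTime Q c g H := by
  funext ω
  rw [optimalTime, hitTime, ← iInf_inf_eq]
  refine iInf_congr fun n => ?_
  refine (iInf_or (s := fun _ => (n : WithTop ℕ))).symm.trans (iInf_congr_Prop ?_ fun _ => rfl)
  rw [stoppingSet, mem_ofPred_eq, value_eq_iterLimit hQ hc hg]
  rcases le_or_gt H (S n ω) with h | h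
  · -- At the horizon both sides of the stopping criterion vanish.
    have h0 : stopCost g (remaining H n ω) = 0 := by
      simp [stopCost, remaining, tsub_eq_zero_of_le h]
    have h1 : iterLimit Q c g (remaining H n ω) ≤ stopCost g (remaining H n ω) := by
      rw [iterLimit_eq_min Q hc hg]
      exact min_le_left _ _
    rw [h0] at h1 ⊢
    simp [h, nonpos_iff_eq_zero.1 h1]
  · have h0 : stopCost g (remaining H n ω) = g (X n ω) := by
      simp [stopCost, remaining, tsub_eq_zero_iff_le, h]
    rw [h0]
    simp [h, remaining]

end SMP

end

theorem mainTheorem6 {E : Type*} [MeasurableSpace E] [StandardBorelSpace E]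
    (Q : SemiMarkovKernel E) (hQ : Q.Regular)
    (c g : E → ℝ≥0) (hc : Measurable c) (hg : Measurable g) (H : ℝ≥0) :
    SMP.IsOptimal Q c g H (SMP.optimalTime Q c g H) ∧
      ∀ x : E, SMP.law Q x {ω | SMP.optimalTime Q c g H ω = ⊤} = 0 := by
  refine ⟨?_, fun x => ?_⟩
  · rw [SMP.optimalTime_eq_hitTime hQ hc hg]
    have hτ := SMP.isStoppingTime_hitTime (Q := Q) hc hg H
    refine ⟨hτ, fun x => ?_⟩
    rw [SMP.value_eq_iterLimit hQ hc hg]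
    exact le_antisymm (SMP.expectedCost_hitTime_le hQ hc hg H x)
      (SMP.iterLimit_le_expectedCost hQ hc hg hτ H x)
  · suffices ∀ᵐ ω ∂(SMP.law Q x), SMP.optimalTime Q c g H ω ≠ ⊤ by simpa [ae_iff] using this
    filter_upwards [SMP.law_S_unbounded hQ x] with ω hω
    obtain ⟨n, hn⟩ := hω H
    have : SMP.optimalTime Q c g H ω ≤ n := inf_le_right.trans (iInf₂_le n hn.le)
    exact (this.trans_lt (WithTop.coe_lt_top n)).ne
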